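/- **Setting.** In a metrical task system (MTS) on a finite metric space $(M,d)$ with starting state $x_0$, at each time $t=1,\dots,T$ a cost function $\ell_t:M\to[0,\infty]$ arrives, and an online algorithm, not knowing the future nor $T$, chooses a state $x_t$ and pays $d(x_{t-1},x_t)+\ell_t(x_t)$. $\mathrm{OPT}$ is the minimum total cost of an offline solution. An *optimal offline algorithm* $\mathrm{OFF}$ outputs for every instance a solution $o_1,\dots,o_T$ of cost $\mathrm{OPT}$. At time $t$, after seeing $\ell_t$ and before choosing $x_t$, an algorithm may query an action predictor and then receives a state $p_t\in M$. It receives predictions *at most once in $a$ time steps* if any two of its queries are at least $a$ steps apart. The prediction error with respect to $\mathrm{OFF}$ is $\eta=\sum d(p_t,o_t)$, the sum being over the times $t\le T$ at which it queries. A randomized algorithm is a random deterministic algorithm; conditions on its error are meant almost surely. For $\rho\ge 0$, an algorithm has *competitive ratio at most $r$ with error at most $\rho\,\mathrm{OPT}$* if there is a constant $\kappa$ such that $\mathbb E[\mathrm{cost}]\le r\cdot\mathrm{OPT}+\kappa$ for all instances and predictions with $\eta\le\rho\cdot\mathrm{OPT}$. For $g:[0,\infty)\to[0,\infty)$, it is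 *$g(\eta/\mathrm{OPT})$-smooth* if for every $\rho\ge0$ its competitive ratio with error at most $\rho\,\mathrm{OPT}$ is at most $g(\rho)$. On the $n$-point uniform metric (all distances between distinct points are $1$), let $\alpha_n^{\det}$ and $\alpha_n^{\mathrm{rand}}$ be the infimum of all $r$ for which there is a deterministic, respectively randomized, $r$-competitive online algorithm that uses no predictions. **Theorem.** There are absolute constants $c,C>0$ such that the following holds. 1. $c\,n\le\alpha_n^{\det}\le C\,n$ for all $n\ge1$, and $c\log n\le\alpha_n^{\mathrm{rand}}\le C\log n$ for all $n\ge2$. 2. Let $n,a\ge1$, let $x_0$ be a starting state, let $\mathrm{OFF}$ be an optimal offline algorithm for MTS on the $n$-point uniform metric, and let $\rho\ge0$. If a deterministic online algorithm that receives predictions at most once in $a$ time steps has competitive ratio at most $r$ with error (with respect to $\mathrm{OFF}$) at most $\rho\,\mathrm{OPT}$, then $r\ge c\cdot\min\{\alpha_n^{\det},\,1+a\rho\}$. The same holds for randomized algorithms with $\alpha_n^{\mathrm{rand}}$ in place of $\alpha_n^{\det}$. That is, the competitive ratio is $\Omega(\min\{\alpha_n,1+a\eta/\mathrm{OPT}\})$.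 3. Hence no algorithm receiving predictions at most once in $a$ time steps is $o(a\eta/\mathrm{OPT})$-smooth: fix an optimal offline algorithm for each $n$ and each starting state, and let $f:\mathbb N\times[0,\infty)\to[0,\infty)$, $a_k\in\mathbb N$ and $\rho_k\ge0$ be such that $a_k\rho_k\to\infty$ and $f(a_k,\rho_k)=o(a_k\rho_k)$ as $k\to\infty$. Then for all sufficiently large $k$ there is no family of (deterministic or randomized) online algorithms, one for each $n$ and each starting state in the $n$-point uniform metric, all of which receive predictions at most once in $a_k$ time steps and are $f(a_k,\eta/\mathrm{OPT})$-smooth. (For instance, one may take $a_k=a$ fixed and $\rho_k\to\infty$.) -/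

import Mathlib

open scoped NNReal ENNReal
open MeasureTheory Filter Asymptotics

namespace MTS

/-- The `n`-point uniform metric space: any two distinct points are at distance `1`. -/
def UniformMetric (n : ℕ) : Type := Fin n

namespace UniformMetric

instance (n : ℕ) : DecidableEq (UniformMetric n) := inferInstanceAs (DecidableEq (Fin n))

instance (n : ℕ) : Fintype (UniformMetric n) := inferInstanceAs (Fintype (Fin n))

noncomputable instance (n : ℕ) : MetricSpace (UniformMetric n) where
  dist x y := if x = y then 0 else 1
  dist_self x := by simp
  dist_comm x y := by simp [eq_comm]
  dist_triangle x y z := by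
    by_cases hxy : x = y
    · subst hxy; simp
    · by_cases hxz : x = z
      · simp only [hxz, if_true]; positivity
      · simp only [hxy, hxz, if_false]
        split_ifs <;> norm_num
  eq_of_dist_eq_zero {x y} h := by
    by_contra hne
    simp [hne] at h

end UniformMetric

variable {M : Type}

/-! ### Metrical task systems

A request sequence is `ℓ 1, …, ℓ T` (the value `ℓ 0` and the values after the horizon `T` play no
role); a solution is `y 0, y 1, …, y T`, where `y 0` is the predefined starting state. -/

/-- A cost function (task) on the set `M` of states; infinite costs are allowed. -/
abbrev CostFn (M : Type) : Type := M → ℝ≥0∞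

/-- The cost `∑_{t=1}^T (d(y_{t-1}, y_t) + ℓ_t(y_t))` of a solution. -/
noncomputable def cost [MetricSpace M] (ℓ : ℕ → CostFn M) (T : ℕ) (y : ℕ → M) : ℝ≥0∞ :=
  ∑ t ∈ Finset.range T, (edist (y t) (y (t + 1)) + ℓ (t + 1) (y (t + 1)))

/-- The offline optimum: the least cost of a solution starting in `x₀`. -/
noncomputable def opt [MetricSpace M] (x₀ : M) (ℓ : ℕ → CostFn M) (T : ℕ) : ℝ≥0∞ :=
  ⨅ (y : ℕ → M) (_ : y 0 = x₀), cost ℓ T y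

/-- An optimal offline algorithm: it sees the whole instance and outputs a solution of
minimum cost. -/
structure OptimalOffline [MetricSpace M] (x₀ : M) where
  sol : (ℕ → CostFn M) → ℕ → ℕ → M
  sol_zero : ∀ ℓ T, sol ℓ T 0 = x₀
  optimal : ∀ ℓ T, cost ℓ T (sol ℓ T) = opt x₀ ℓ T

/-! ### Online algorithms querying an action predictor -/

/-- What an online algorithm has seen: the tasks received so far, in order of arrival, each with the
answer of the predictor in that time step (`none` if the predictor was not queried). -/
abbrev History (M : Type) : Type := List (CostFn M × Option M)

/-- A deterministic online algorithm. In each time step it receives a task, decides from the history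
and that task whether to query the predictor, receives the answer if it does, and then decides from
the history, which now includes the current step, to which state it moves. -/
structure DetAlg (M : Type) where
  query : History M → CostFn M → Bool
  move : History M → M

namespace DetAlg

/-- The history after `t` time steps, where `p t` is the state which the predictor reports if it is
queried at time `t`. -/
def hist (A : DetAlg M) (ℓ : ℕ → CostFn M) (p : ℕ → M) : ℕ → History M
  | 0 => []
  | t + 1 => hist A ℓ p t ++
      [(ℓ (t + 1), if A.query (hist A ℓ p t) (ℓ (t + 1)) then some (p (t + 1)) else none)]

variable (A : DetAlg M)

/-- The state of the algorithm at time `t`. -/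
def state (x₀ : M) (ℓ : ℕ → CostFn M) (p : ℕ → M) : ℕ → M
  | 0 => x₀
  | t + 1 => A.move (A.hist ℓ p (t + 1))

/-- Whether the algorithm queries the predictor at time `t`, for `t ≥ 1`. -/
def queried (ℓ : ℕ → CostFn M) (p : ℕ → M) : ℕ → Bool
  | 0 => false
  | t + 1 => A.query (A.hist ℓ p t) (ℓ (t + 1))

/-- The total prediction error: the sum, over the time steps `t ≤ T` with a query, of the distances
of the received prediction from the state of the offline solution `o`. -/
noncomputable def predError [MetricSpace M] (ℓ : ℕ → CostFn M) (p : ℕ → M) (T : ℕ)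
    (o : ℕ → M) : ℝ≥0∞ :=
  ∑ t ∈ Finset.range T, if A.queried ℓ p (t + 1) then edist (p (t + 1)) (o (t + 1)) else 0

/-- Any two queries are separated by at least `a` time steps. -/
def WellSeparated (a : ℕ) : Prop :=
  ∀ (ℓ : ℕ → CostFn M) (p : ℕ → M) (s t : ℕ), s < t →
    A.queried ℓ p s = true → A.queried ℓ p t = true → s + a ≤ t

/-- The algorithm does not use predictions. -/
def NeverQueries : Prop := ∀ h c, A.query h c = false

end DetAlg

/-- A randomized online algorithm: a random deterministic one, chosen from a probability space, such
that on every instance its states and queries are random variables. -/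
structure RandAlg (M : Type) where
  Ω : Type
  [mΩ : MeasurableSpace Ω]
  μ : Measure Ω
  [prob : IsProbabilityMeasure μ]
  alg : Ω → DetAlg M
  measurable_state : ∀ (x₀ : M) (ℓ : ℕ → CostFn M) (p : ℕ → M) (t : ℕ) (S : Set M),
    MeasurableSet {ω | (alg ω).state x₀ ℓ p t ∈ S}
  measurable_queried : ∀ (ℓ : ℕ → CostFn M) (p : ℕ → M) (t : ℕ),
    MeasurableSet {ω | (alg ω).queried ℓ p t = true}

attribute [instance] RandAlg.mΩ RandAlg.prob

/-- A deterministic algorithm as a (degenerate) randomized one. -/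
noncomputable def DetAlg.toRand (A : DetAlg M) : RandAlg M where
  Ω := Unit
  μ := Measure.dirac ()
  alg := fun _ => A
  measurable_state := fun _ _ _ _ _ => MeasurableSpace.measurableSet_top
  measurable_queried := fun _ _ _ => MeasurableSpace.measurableSet_top

namespace RandAlg

variable (R : RandAlg M)

/-- In every outcome, any two queries are separated by at least `a` time steps. -/
def WellSeparated (a : ℕ) : Prop := ∀ ω, (R.alg ω).WellSeparated a

/-- The algorithm does not use predictions. -/
def NeverQueries : Prop := ∀ ω, (R.alg ω).NeverQueries

variable [MetricSpace M]

/-- The expected cost of the algorithm on `ℓ 1, …, ℓ T` with the predictor `p`. -/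
noncomputable def expectedCost (x₀ : M) (ℓ : ℕ → CostFn M) (p : ℕ → M) (T : ℕ) : ℝ≥0∞ :=
  ∫⁻ ω, cost ℓ T ((R.alg ω).state x₀ ℓ p) ∂(R.μ)

/-- `r`-competitiveness on all instances, whatever the predictor says. -/
def IsCompetitive (x₀ : M) (r : ℝ≥0) : Prop :=
  ∃ κ : ℝ≥0, ∀ (ℓ : ℕ → CostFn M) (p : ℕ → M) (T : ℕ),
    R.expectedCost x₀ ℓ p T ≤ r * opt x₀ ℓ T + κ

/-- `r`-competitiveness whenever the total prediction error `η` with respect to the optimal offline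
algorithm `off` satisfies `η ≤ ρ · OPT`. -/
def IsCompetitiveWithError (x₀ : M) (off : OptimalOffline x₀) (ρ r : ℝ≥0) : Prop :=
  ∃ κ : ℝ≥0, ∀ (ℓ : ℕ → CostFn M) (p : ℕ → M) (T : ℕ),
    (∀ᵐ ω ∂(R.μ), (R.alg ω).predError ℓ p T (off.sol ℓ T) ≤ ρ * opt x₀ ℓ T) →
      R.expectedCost x₀ ℓ p T ≤ r * opt x₀ ℓ T + κ

/-- `g(η / OPT)`-smoothness: for every `ρ`, the competitive ratio is at most `g ρ` whenever the
total prediction error is at most `ρ · OPT`. -/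
def IsSmooth (x₀ : M) (off : OptimalOffline x₀) (g : ℝ≥0 → ℝ≥0) : Prop :=
  ∀ ρ : ℝ≥0, R.IsCompetitiveWithError x₀ off ρ (g ρ)

end RandAlg

/-- The optimal competitive ratio of deterministic algorithms without predictions. -/
noncomputable def detRatio [MetricSpace M] (x₀ : M) : ℝ≥0∞ :=
  ⨅ (r : ℝ≥0) (_ : ∃ A : DetAlg M, A.NeverQueries ∧ A.toRand.IsCompetitive x₀ r), (r : ℝ≥0∞)

/-- The optimal competitive ratio of randomized algorithms without predictions. -/
noncomputable def randRatio [MetricSpace M] (x₀ : M) : ℝ≥0∞ :=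
  ⨅ (r : ℝ≥0) (_ : ∃ R : RandAlg M, R.NeverQueries ∧ R.IsCompetitive x₀ r), (r : ℝ≥0∞)

end MTS

/-!
For the lower bounds an adversary plays phases of `k + 1` tasks, each of which charges `1` outside a
shrinking set of surviving states. Whenever the algorithm is found outside the survivors it pays
`1`, by moving to them or by staying out. If the algorithm is evicted with probability at least `q`
in each of the first `k` steps, and everybody is charged in the last one, then it pays at least
`k q + 1` per phase, while the offline optimum, which moves to the last survivor, increases by
between `1` and `2`. Erasing the current state of a deterministic algorithm gives `q = 1` and
`k = n - 1`; keeping the half of the survivors where a randomized algorithm is less likely to be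
gives `q = 1 / 2` and `k = log₂ n`. Predictions do not help: `N` phases consist of `N (k + 1)` steps
with at most `N (k + 1) / a + 1` queries, so if `k + 1 < a ρ` then even predictions that are always
wrong stay within the error budget `ρ OPT ≥ ρ N` for large `N`.

For the upper bounds on `α_n` a phase lasts until cost `1` has accumulated on every state, which
costs any offline solution at least `1`. The marking algorithm stays on a state that is not yet
saturated in this sense, the first one in an order of the states. In a uniformly random order, a
given one of `u` unsaturated states comes first with probability `1 / u`, and a phase costs
`O(1 + 1 / 2 + ⋯ + 1 / n)` in expectation; in a fixed order this probability is at most `1`, and a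
phase costs `O(n)`.
-/

namespace MTS

section Horizon

variable {M : Type}

theorem DetAlg.hist_congr (A : DetAlg M) {ℓ ℓ' : ℕ → CostFn M} (p : ℕ → M) {t : ℕ}
    (h : Set.EqOn ℓ ℓ' (Set.Iic t)) : A.hist ℓ p t = A.hist ℓ' p t := by
  induction t with
  | zero => rfl
  | succ t ih =>
    simp only [DetAlg.hist, ih (h.mono (Set.Iic_subset_Iic.2 t.le_succ)), h Set.self_mem_Iic]

theorem DetAlg.state_congr (A : DetAlg M) (x₀ : M) {ℓ ℓ' : ℕ → CostFn M} (p : ℕ → M) {t : ℕ}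
    (h : Set.EqOn ℓ ℓ' (Set.Iic t)) : A.state x₀ ℓ p t = A.state x₀ ℓ' p t := by
  cases t with
  | zero => rfl
  | succ t => simp only [DetAlg.state, A.hist_congr p h]

theorem eqOn_update_succ (ℓ : ℕ → CostFn M) (T : ℕ) (c : CostFn M) :
    Set.EqOn (Function.update ℓ (T + 1) c) ℓ (Set.Iic T) := fun _ ht =>
  Function.update_of_ne (Nat.lt_succ_of_le ht).ne _ _

variable [MetricSpace M]

theorem cost_succ (ℓ : ℕ → CostFn M) (T : ℕ) (y : ℕ → M) :
    cost ℓ (T + 1) y = cost ℓ T y + (edist (y T) (y (T + 1)) + ℓ (T + 1) (y (T + 1))) :=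
  Finset.sum_range_succ _ _

theorem cost_congr {ℓ ℓ' : ℕ → CostFn M} {T : ℕ} {y y' : ℕ → M}
    (h : Set.EqOn ℓ ℓ' (Set.Iic T)) (hy : Set.EqOn y y' (Set.Iic T)) :
    cost ℓ T y = cost ℓ' T y' := by
  refine Finset.sum_congr rfl fun t ht => ?_
  have ht : t + 1 ≤ T := Finset.mem_range.1 ht
  rw [h ht, hy ht, hy (show t ≤ T by omega)]

theorem opt_congr (x₀ : M) {ℓ ℓ' : ℕ → CostFn M} {T : ℕ} (h : Set.EqOn ℓ ℓ' (Set.Iic T)) :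
    opt x₀ ℓ T = opt x₀ ℓ' T := by
  simp only [opt, cost_congr h (Set.eqOn_refl _ _)]

theorem opt_le_cost {x₀ : M} (ℓ : ℕ → CostFn M) (T : ℕ) {y : ℕ → M} (hy : y 0 = x₀) :
    opt x₀ ℓ T ≤ cost ℓ T y :=
  iInf₂_le y hy

theorem opt_add_le_opt_succ (x₀ : M) {ℓ : ℕ → CostFn M} {T : ℕ} {b : ℝ≥0∞}
    (h : ∀ x, b ≤ ℓ (T + 1) x) : opt x₀ ℓ T + b ≤ opt x₀ ℓ (T + 1) :=
  le_iInf₂ fun y hy => by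
    rw [cost_succ]
    exact add_le_add (opt_le_cost ℓ T hy) ((h _).trans le_add_self)

theorem opt_le_opt_succ (x₀ : M) (ℓ : ℕ → CostFn M) (T : ℕ) : opt x₀ ℓ T ≤ opt x₀ ℓ (T + 1) := by
  simpa using opt_add_le_opt_succ x₀ (ℓ := ℓ) (T := T) (b := 0) fun _ => zero_le

theorem opt_zero (x₀ : M) (ℓ : ℕ → CostFn M) : opt x₀ ℓ 0 = 0 :=
  nonpos_iff_eq_zero.1 (opt_le_cost (y := fun _ => x₀) ℓ 0 rfl)

theorem opt_const_one (x₀ : M) (T : ℕ) : opt x₀ (fun _ _ => 1) T = T := by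
  refine le_antisymm ((opt_le_cost (y := fun _ => x₀) _ _ rfl).trans (by simp [cost])) ?_
  induction T with
  | zero => simp
  | succ T ih =>
    push_cast
    exact (add_le_add_left ih 1).trans (opt_add_le_opt_succ x₀ fun _ => le_rfl)

/-- The work function: the least cost of serving the tasks up to time `T` and then moving to `s`. -/
noncomputable def workFunction (x₀ : M) (ℓ : ℕ → CostFn M) (T : ℕ) (s : M) : ℝ≥0∞ :=
  ⨅ (y : ℕ → M) (_ : y 0 = x₀), (cost ℓ T y + edist (y T) s)

theorem workFunction_congr (x₀ : M) {ℓ ℓ' : ℕ → CostFn M} {T : ℕ}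
    (h : Set.EqOn ℓ ℓ' (Set.Iic T)) (s : M) :
    workFunction x₀ ℓ T s = workFunction x₀ ℓ' T s := by
  simp only [workFunction, cost_congr h (Set.eqOn_refl _ _)]

theorem opt_le_workFunction (x₀ : M) (ℓ : ℕ → CostFn M) (T : ℕ) (s : M) :
    opt x₀ ℓ T ≤ workFunction x₀ ℓ T s :=
  iInf₂_mono fun _ _ => le_self_add

theorem workFunction_succ_le (x₀ : M) (ℓ : ℕ → CostFn M) (T : ℕ) (s : M) :
    workFunction x₀ ℓ (T + 1) s ≤ workFunction x₀ ℓ T s + ℓ (T + 1) s := by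
  simp only [workFunction, iInf_subtype', ENNReal.iInf_add]
  refine le_iInf fun ⟨y, hy⟩ => ?_
  have hagree : Set.EqOn (Function.update y (T + 1) s) y (Set.Iic T) := fun t ht =>
    Function.update_of_ne (Nat.lt_succ_of_le ht).ne _ _
  refine iInf_le_of_le ⟨Function.update y (T + 1) s, (hagree T.zero_le).trans hy⟩ ?_
  simp only [cost_succ, cost_congr (Set.eqOn_refl ℓ _) hagree, hagree Set.self_mem_Iic,
    Function.update_self, edist_self, add_zero, add_assoc, le_refl]

end Horizon

section ExpectedCost

variable {M : Type} [MetricSpace M] (R : RandAlg M) (x₀ : M)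

theorem RandAlg.expectedCost_congr {ℓ ℓ' : ℕ → CostFn M} (p : ℕ → M) {T : ℕ}
    (h : Set.EqOn ℓ ℓ' (Set.Iic T)) : R.expectedCost x₀ ℓ p T = R.expectedCost x₀ ℓ' p T :=
  lintegral_congr fun ω => cost_congr h fun _ ht =>
    (R.alg ω).state_congr x₀ p (h.mono (Set.Iic_subset_Iic.2 ht))

theorem RandAlg.opt_le_expectedCost (ℓ : ℕ → CostFn M) (p : ℕ → M) (T : ℕ) :
    opt x₀ ℓ T ≤ R.expectedCost x₀ ℓ p T := by
  calc opt x₀ ℓ T = ∫⁻ _, opt x₀ ℓ T ∂(R.μ) := by simp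
    _ ≤ R.expectedCost x₀ ℓ p T := lintegral_mono fun _ => opt_le_cost ℓ T rfl

variable {R x₀}

theorem RandAlg.IsCompetitive.of_forall_cost {r κ : ℝ≥0}
    (h : ∀ (ℓ : ℕ → CostFn M) (p : ℕ → M) (T : ℕ) (y : ℕ → M), y 0 = x₀ →
      R.expectedCost x₀ ℓ p T ≤ r * cost ℓ T y + κ) : R.IsCompetitive x₀ r := by
  refine ⟨κ, fun ℓ p T => ?_⟩
  rw [opt, iInf_subtype', ENNReal.mul_iInf' (fun h => absurd h ENNReal.coe_ne_top) fun _ =>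
    ⟨⟨fun _ => x₀, rfl⟩⟩, ENNReal.iInf_add]
  exact le_iInf fun y => h ℓ p T y y.2

end ExpectedCost

namespace UniformMetric

variable {n : ℕ}

theorem edist_eq (x y : UniformMetric n) : edist x y = if x = y then 0 else 1 := by
  rw [edist_dist]
  change ENNReal.ofReal (if x = y then 0 else 1) = _
  split_ifs <;> simp

theorem edist_le_one (x y : UniformMetric n) : edist x y ≤ 1 := by
  rw [edist_eq]
  split_ifs <;> simp

theorem edist_of_ne {x y : UniformMetric n} (h : x ≠ y) : edist x y = 1 := by
  rw [edist_eq, if_neg h]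

theorem card_eq : Fintype.card (UniformMetric n) = n :=
  Fintype.card_fin n

theorem pos (x : UniformMetric n) : 0 < n :=
  Fin.pos (n := n) x

theorem workFunction_le_opt_add_one (x₀ : UniformMetric n) (ℓ : ℕ → CostFn (UniformMetric n))
    (T : ℕ) (s : UniformMetric n) : workFunction x₀ ℓ T s ≤ opt x₀ ℓ T + 1 := by
  simp only [workFunction, opt, iInf_subtype', ENNReal.iInf_add]
  exact iInf_mono fun y => add_le_add le_rfl (edist_le_one _ _)

end UniformMetric

/-- The task that charges `1` outside of `S`. -/
noncomputable def evictionTask {M : Type} (S : Finset M) : CostFn M :=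
  (S : Set M)ᶜ.indicator 1

/-- The adversary can evade the algorithm: from any set of at least `m (j + 1)` states it can
retreat to `m j` of them which the algorithm, at the given time, misses with probability at least
`q`. -/
def RandAlg.IsEvadable {M : Type} (R : RandAlg M) (x₀ : M) (m : ℕ → ℕ) (q : ℝ≥0) : Prop :=
  0 < m 0 ∧ ∀ (ℓ : ℕ → CostFn M) (p : ℕ → M) (t j : ℕ) (S : Finset M), m (j + 1) ≤ S.card →
    ∃ S' ⊆ S, m j ≤ S'.card ∧ q ≤ R.μ {ω | (R.alg ω).state x₀ ℓ p t ∉ S'}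

section Evadable

variable {M : Type}

theorem DetAlg.isEvadable (A : DetAlg M) (x₀ : M) : A.toRand.IsEvadable x₀ (· + 1) 1 := by
  classical
  refine ⟨one_pos, fun ℓ p t j S hS => ⟨S.erase (A.state x₀ ℓ p t), S.erase_subset _, ?_, ?_⟩⟩
  · exact (Nat.le_sub_one_of_lt hS).trans Finset.pred_card_le_card_erase
  · have hmiss : {ω | (A.toRand.alg ω).state x₀ ℓ p t ∉ S.erase (A.state x₀ ℓ p t)} = Set.univ :=
      Set.eq_univ_of_forall fun _ => Finset.notMem_erase _ _
    rw [hmiss, measure_univ, ENNReal.coe_one]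

theorem RandAlg.isEvadable (R : RandAlg M) (x₀ : M) : R.IsEvadable x₀ (2 ^ ·) 2⁻¹ := by
  classical
  refine ⟨by simp, fun ℓ p t j S hS => ?_⟩
  obtain ⟨S₁, hS₁, hcard⟩ := Finset.exists_subset_card_eq
    ((Nat.pow_le_pow_right two_pos j.le_succ).trans hS)
  have hcover : {ω | (R.alg ω).state x₀ ℓ p t ∉ S₁} ∪
      {ω | (R.alg ω).state x₀ ℓ p t ∉ S \ S₁} = Set.univ := by
    ext ω
    simp only [Set.mem_union, Set.mem_ofPred_eq, Finset.mem_sdiff, Set.mem_univ, iff_true]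
    tauto
  have hsum : 1 ≤ R.μ {ω | (R.alg ω).state x₀ ℓ p t ∉ S₁} +
      R.μ {ω | (R.alg ω).state x₀ ℓ p t ∉ S \ S₁} := by
    rw [← measure_univ (μ := R.μ), ← hcover]
    exact measure_union_le _ _
  rcases le_or_gt (2⁻¹ : ℝ≥0∞) (R.μ {ω | (R.alg ω).state x₀ ℓ p t ∉ S₁}) with h | h
  · exact ⟨S₁, hS₁, hcard.ge, by simpa using h⟩
  · refine ⟨S \ S₁, Finset.sdiff_subset, ?_, ?_⟩
    · rw [Finset.card_sdiff_of_subset hS₁, hcard]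
      grind
    · push_cast
      by_contra! h'
      exact (hsum.trans_lt (ENNReal.add_lt_add h (by simpa using h'))).ne
        ENNReal.inv_two_add_inv_two.symm

end Evadable

section Adversary

variable {n : ℕ} {R : RandAlg (UniformMetric n)} {x₀ : UniformMetric n} {m : ℕ → ℕ} {q : ℝ≥0}
  {k : ℕ}

/-- Wherever the algorithm was outside of `S`, it pays `1` for either moving into `S` or not. -/
theorem RandAlg.expectedCost_add_le_evictionTask (R : RandAlg (UniformMetric n))
    (x₀ : UniformMetric n) (ℓ : ℕ → CostFn (UniformMetric n)) (p : ℕ → UniformMetric n) (T : ℕ)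
    (S : Finset (UniformMetric n)) :
    R.expectedCost x₀ ℓ p T + R.μ {ω | (R.alg ω).state x₀ ℓ p T ∉ S} ≤
      R.expectedCost x₀ (Function.update ℓ (T + 1) (evictionTask S)) p (T + 1) := by
  have hagree := eqOn_update_succ ℓ T (evictionTask S)
  have hmiss : MeasurableSet {ω | (R.alg ω).state x₀ ℓ p T ∉ S} :=
    R.measurable_state x₀ ℓ p T {x | x ∉ S}
  rw [← R.expectedCost_congr x₀ p hagree, ← lintegral_indicator_one hmiss]
  refine (le_lintegral_add _ _).trans (lintegral_mono fun ω => ?_)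
  dsimp only
  rw [cost_succ, Function.update_self, (R.alg ω).state_congr x₀ p hagree]
  refine add_le_add le_rfl ?_
  rw [Set.indicator_apply]
  split_ifs with hω
  swap; · exact zero_le
  set x := (R.alg ω).state x₀ (Function.update ℓ (T + 1) (evictionTask S)) p (T + 1)
  by_cases hx : x ∈ S
  · rw [UniformMetric.edist_of_ne (ne_of_mem_of_not_mem hx hω).symm]
    exact le_self_add
  · simp [evictionTask, hx]

theorem RandAlg.IsEvadable.exists_partial_phase (hR : R.IsEvadable x₀ m q) (hk : m k ≤ n)
    (ℓ : ℕ → CostFn (UniformMetric n)) (p : ℕ → UniformMetric n) (T : ℕ) {i : ℕ} (hi : i ≤ k) :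
    ∃ (ℓ' : ℕ → CostFn (UniformMetric n)) (S : Finset (UniformMetric n)),
      m (k - i) ≤ S.card ∧ (∀ s ∈ S, workFunction x₀ ℓ' (T + i) s ≤ opt x₀ ℓ T + 1) ∧
      opt x₀ ℓ T ≤ opt x₀ ℓ' (T + i) ∧
      R.expectedCost x₀ ℓ p T + i * q ≤ R.expectedCost x₀ ℓ' p (T + i) := by
  induction i with
  | zero =>
    refine ⟨ℓ, Finset.univ, ?_, fun s _ => UniformMetric.workFunction_le_opt_add_one x₀ ℓ T s,
      le_rfl, by simp⟩
    rwa [Finset.card_univ, UniformMetric.card_eq]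
  | succ i ih =>
    obtain ⟨ℓ₁, S₁, hcard₁, hwork, hopt, hcost⟩ := ih (by omega)
    rw [show k - i = k - (i + 1) + 1 by omega] at hcard₁
    obtain ⟨S, hS, hcard, hq⟩ := hR.2 ℓ₁ p (T + i) _ S₁ hcard₁
    have hagree := eqOn_update_succ ℓ₁ (T + i) (evictionTask S)
    refine ⟨Function.update ℓ₁ (T + i + 1) (evictionTask S), S, hcard, fun s hs => ?_, ?_, ?_⟩
    · refine (workFunction_succ_le _ _ (T + i) _).trans ?_
      rw [workFunction_congr x₀ hagree, Function.update_self]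
      simpa [evictionTask, hs] using hwork s (hS hs)
    · rw [← opt_congr x₀ hagree] at hopt
      exact hopt.trans (opt_le_opt_succ _ _ _)
    · refine le_trans ?_ (R.expectedCost_add_le_evictionTask x₀ ℓ₁ p (T + i) S)
      push_cast
      rw [add_mul, one_mul, ← add_assoc]
      exact add_le_add hcost hq

theorem RandAlg.IsEvadable.exists_phase (hR : R.IsEvadable x₀ m q) (hk : m k ≤ n)
    (ℓ : ℕ → CostFn (UniformMetric n)) (p : ℕ → UniformMetric n) (T : ℕ) :
    ∃ ℓ' : ℕ → CostFn (UniformMetric n),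
      opt x₀ ℓ T + 1 ≤ opt x₀ ℓ' (T + (k + 1)) ∧ opt x₀ ℓ' (T + (k + 1)) ≤ opt x₀ ℓ T + 2 ∧
      R.expectedCost x₀ ℓ p T + (k * q + 1) ≤ R.expectedCost x₀ ℓ' p (T + (k + 1)) := by
  obtain ⟨ℓ₁, S, hcard, hwork, hopt, hcost⟩ := hR.exists_partial_phase hk ℓ p T le_rfl
  rw [Nat.sub_self] at hcard
  obtain ⟨s, hs⟩ := Finset.card_pos.1 (hR.1.trans_le hcard)
  have hagree := eqOn_update_succ ℓ₁ (T + k) (evictionTask ∅)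
  refine ⟨Function.update ℓ₁ (T + k + 1) (evictionTask ∅), ?_, ?_, ?_⟩
  · rw [← opt_congr x₀ hagree] at hopt
    exact (add_le_add_left hopt 1).trans
      (opt_add_le_opt_succ x₀ fun x => by simp [evictionTask])
  · refine (opt_le_workFunction _ _ _ s).trans ((workFunction_succ_le _ _ (T + k) _).trans ?_)
    rw [workFunction_congr x₀ hagree, Function.update_self]
    calc workFunction x₀ ℓ₁ (T + k) s + evictionTask ∅ s ≤ opt x₀ ℓ T + 1 + 1 :=
          add_le_add (hwork s hs) (by simp [evictionTask])
      _ = opt x₀ ℓ T + 2 := by rw [add_assoc, one_add_one_eq_two]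
  · have hlast := R.expectedCost_add_le_evictionTask x₀ ℓ₁ p (T + k) ∅
    simp only [Finset.notMem_empty, not_false_eq_true, Set.ofPred_true, measure_univ] at hlast
    rw [← add_assoc]
    exact (add_le_add_left hcost 1).trans hlast

theorem RandAlg.IsEvadable.exists_hard_instance (hR : R.IsEvadable x₀ m q) (hk : m k ≤ n)
    (p : ℕ → UniformMetric n) (N : ℕ) :
    ∃ ℓ : ℕ → CostFn (UniformMetric n),
      (N : ℝ≥0∞) ≤ opt x₀ ℓ (N * (k + 1)) ∧ opt x₀ ℓ (N * (k + 1)) ≤ 2 * N ∧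
      N * (k * q + 1) ≤ R.expectedCost x₀ ℓ p (N * (k + 1)) := by
  induction N with
  | zero => exact ⟨0, by simp, by simp [opt_zero], by simp⟩
  | succ N ih =>
    obtain ⟨ℓ, hN, hopt, hcost⟩ := ih
    obtain ⟨ℓ', hN', hopt', hcost'⟩ := hR.exists_phase hk ℓ p (N * (k + 1))
    rw [← Nat.succ_mul] at hN' hopt' hcost'
    refine ⟨ℓ', ?_, ?_, ?_⟩ <;> push_cast
    · exact (add_le_add_left hN 1).trans hN'
    · rw [mul_add_one (2 : ℝ≥0∞)]
      exact hopt'.trans (add_le_add_left hopt 2)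
    · rw [add_mul, one_mul]
      exact (add_le_add_left hcost _).trans hcost'

end Adversary

theorem eventually_natCast_mul_add_le {x y : ℝ≥0} (h : x < y) (κ : ℝ≥0) :
    ∀ᶠ N : ℕ in atTop, N * x + κ ≤ N * y := by
  obtain ⟨δ, hδ, rfl⟩ := exists_pos_add_of_lt' h
  filter_upwards [(tendsto_natCast_atTop_atTop.atTop_mul_const hδ).eventually_ge_atTop κ]
    with N hN
  rw [mul_add]
  gcongr

theorem le_of_eventually_natCast_mul_le {x y κ : ℝ≥0}
    (h : ∀ᶠ N : ℕ in atTop, N * x ≤ N * y + κ) : x ≤ y := by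
  by_contra! hyx
  obtain ⟨N, hN, hN'⟩ := (h.and (eventually_natCast_mul_add_le hyx (κ + 1))).exists
  rw [← add_assoc] at hN'
  exact (hN.trans_lt (lt_add_one _)).not_ge hN'

theorem RandAlg.IsCompetitiveWithError.one_le {M : Type} [MetricSpace M] {R : RandAlg M} {x₀ : M}
    {off : OptimalOffline x₀} {ρ r : ℝ≥0} (hR : R.IsCompetitiveWithError x₀ off ρ r) :
    1 ≤ r := by
  obtain ⟨κ, hκ⟩ := hR
  refine le_of_eventually_natCast_mul_le (κ := κ) (.of_forall fun N => ?_)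
  set ℓ : ℕ → CostFn M := fun _ _ => 1
  have hcost := (R.opt_le_expectedCost x₀ ℓ (off.sol ℓ N) N).trans
    (hκ ℓ (off.sol ℓ N) N (.of_forall fun ω => by simp [DetAlg.predError]))
  rw [opt_const_one, mul_comm] at hcost
  rw [mul_one]
  exact_mod_cast hcost

theorem DetAlg.WellSeparated.mul_card_queried_le {M : Type} {A : DetAlg M} {a : ℕ}
    (hA : A.WellSeparated a) (ℓ : ℕ → CostFn M) (p : ℕ → M) (T : ℕ) :
    a * ((Finset.range T).filter fun t => A.queried ℓ p (t + 1) = true).card ≤ T + a := by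
  rcases a.eq_zero_or_pos with rfl | ha
  · simp
  have hlt : ∀ {s t}, s < t → A.queried ℓ p (s + 1) = true → A.queried ℓ p (t + 1) = true →
      s / a < t / a := fun {s t} hst hs ht => by
    have hsep : s + a ≤ t := by have := hA ℓ p (s + 1) (t + 1) (by omega) hs ht; omega
    calc s / a < (s + a) / a := by rw [Nat.add_div_right _ ha]; exact Nat.lt_succ_self _
      _ ≤ t / a := Nat.div_le_div_right hsep
  have hcard : ((Finset.range T).filter fun t => A.queried ℓ p (t + 1) = true).card ≤
      (Finset.range (T / a + 1)).card := by
    refine Finset.card_le_card_of_injOn (· / a) (fun t ht => ?_) ?_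
    · have ht := Finset.mem_range.1 (Finset.mem_filter.1 ht).1
      simpa using Nat.lt_succ_of_le (Nat.div_le_div_right ht.le)
    · intro s hs t ht hst
      have hs := (Finset.mem_filter.1 hs).2
      have ht := (Finset.mem_filter.1 ht).2
      by_contra hne
      rcases lt_or_gt_of_ne hne with h | h
      · exact (hlt h hs ht).ne hst
      · exact (hlt h ht hs).ne' hst
  rw [Finset.card_range] at hcard
  calc _ ≤ a * (T / a + 1) := Nat.mul_le_mul_left _ hcard
    _ ≤ T + a := by rw [mul_add, mul_one]; exact Nat.add_le_add_right (Nat.mul_div_le T a) a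

section LowerBound

variable {n : ℕ} {R : RandAlg (UniformMetric n)} {x₀ : UniformMetric n} {m : ℕ → ℕ} {q : ℝ≥0}
  {k : ℕ}

theorem DetAlg.WellSeparated.mul_predError_le {A : DetAlg (UniformMetric n)} {a : ℕ}
    (hA : A.WellSeparated a) (ℓ : ℕ → CostFn (UniformMetric n)) (p : ℕ → UniformMetric n)
    (T : ℕ) (o : ℕ → UniformMetric n) : a * A.predError ℓ p T o ≤ T + a := by
  have hcard : A.predError ℓ p T o ≤
      ((Finset.range T).filter fun t => A.queried ℓ p (t + 1) = true).card := by
    rw [DetAlg.predError, ← Finset.sum_filter]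
    refine (Finset.sum_le_card_nsmul _ _ 1 fun t _ => UniformMetric.edist_le_one _ _).trans ?_
    simp
  exact (mul_le_mul' le_rfl hcard).trans (by exact_mod_cast hA.mul_card_queried_le ℓ p T)

theorem RandAlg.IsEvadable.le_two_mul (hR : R.IsEvadable x₀ m q) (hk : m k ≤ n) {r κ : ℝ≥0}
    (p : ℕ → UniformMetric n)
    (hr : ∀ᶠ N : ℕ in atTop, ∀ ℓ, (N : ℝ≥0∞) ≤ opt x₀ ℓ (N * (k + 1)) →
      R.expectedCost x₀ ℓ p (N * (k + 1)) ≤ r * opt x₀ ℓ (N * (k + 1)) + κ) :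
    k * q + 1 ≤ 2 * r := by
  refine le_of_eventually_natCast_mul_le (κ := κ) (hr.mono fun N hN => ?_)
  obtain ⟨ℓ, hle, hopt, hcost⟩ := hR.exists_hard_instance hk p N
  have h : (N * (k * q + 1) : ℝ≥0∞) ≤ N * (2 * r) + κ :=
    calc _ ≤ r * opt x₀ ℓ (N * (k + 1)) + κ := hcost.trans (hN ℓ hle)
      _ ≤ r * (2 * N) + κ := by gcongr
      _ = _ := by ring
  exact_mod_cast h

theorem RandAlg.IsCompetitive.le_two_mul {r : ℝ≥0} (hR : R.IsCompetitive x₀ r)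
    (hm : R.IsEvadable x₀ m q) (hk : m k ≤ n) : k * q + 1 ≤ 2 * r := by
  obtain ⟨κ, hκ⟩ := hR
  exact hm.le_two_mul hk (fun _ => x₀) (.of_forall fun _ ℓ _ => hκ ℓ _ _)

theorem RandAlg.IsCompetitiveWithError.le_two_mul {off : OptimalOffline x₀} {ρ r : ℝ≥0}
    (hR : R.IsCompetitiveWithError x₀ off ρ r) {a : ℕ} (hsep : R.WellSeparated a)
    (hm : R.IsEvadable x₀ m q) (hk : m k ≤ n) (hka : (k + 1 : ℝ≥0) < a * ρ) :
    k * q + 1 ≤ 2 * r := by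
  obtain ⟨κ, hκ⟩ := hR
  have ha : (a : ℝ≥0∞) ≠ 0 := by
    rw [Nat.cast_ne_zero]
    rintro rfl
    simp at hka
  refine hm.le_two_mul (κ := κ) hk (fun _ => x₀) ?_
  filter_upwards [eventually_natCast_mul_add_le hka a] with N hN ℓ hopt
  refine hκ ℓ _ _ (.of_forall fun ω => ?_)
  have hN' : ((N * (k + 1) : ℕ) + a : ℝ≥0∞) ≤ N * (a * ρ) := by exact_mod_cast hN
  rw [← ENNReal.mul_le_mul_iff_right ha (ENNReal.natCast_ne_top a)]
  calc _ ≤ ((N * (k + 1) : ℕ) + a : ℝ≥0∞) := (hsep ω).mul_predError_le _ _ _ _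
    _ ≤ N * (a * ρ) := hN'
    _ = a * (ρ * N) := by ring
    _ ≤ _ := by gcongr

theorem exists_natCast_add_one_lt_and_min_le (K : ℕ) (x : ℝ≥0) :
    ∃ k ≤ K, (1 < x → (k + 1 : ℝ≥0) < x) ∧ min (K + 1 : ℝ≥0) x ≤ k + 2 := by
  refine ⟨min K (⌈x⌉₊ - 2), min_le_left _ _, fun hx => ?_, ?_⟩
  · have hceil : 1 < ⌈x⌉₊ := Nat.lt_ceil.2 (by simpa using hx)
    exact_mod_cast Nat.lt_ceil.1 (show min K (⌈x⌉₊ - 2) + 1 < ⌈x⌉₊ by omega)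
  · calc min (K + 1 : ℝ≥0) x ≤ min ((K + 1 : ℕ) : ℝ≥0) ⌈x⌉₊ := by
          push_cast
          exact min_le_min le_rfl (Nat.le_ceil x)
      _ ≤ ((min K (⌈x⌉₊ - 2) + 2 : ℕ) : ℝ≥0) := by
          rw [← Nat.cast_min]
          exact Nat.cast_le.2 (by omega)
      _ = _ := by push_cast; rfl

theorem RandAlg.IsCompetitiveWithError.mul_one_add_min_le {off : OptimalOffline x₀} {ρ r : ℝ≥0}
    (hR : R.IsCompetitiveWithError x₀ off ρ r) {a : ℕ} (hsep : R.WellSeparated a)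
    (hm : R.IsEvadable x₀ m q) (hq : q ≤ 1) {K : ℕ} (hK : ∀ k ≤ K, m k ≤ n) :
    q * (1 + min (K + 1 : ℝ≥0) (a * ρ)) ≤ 4 * r := by
  have hr : (1 : ℝ) ≤ r := hR.one_le
  obtain ⟨k, hkK, hlt, hle⟩ := exists_natCast_add_one_lt_and_min_le K (a * ρ)
  by_cases h1 : 1 < a * ρ
  · have hkq : (k * q + 1 : ℝ) ≤ 2 * r := hR.le_two_mul hsep hm (hK k hkK) (hlt h1)
    calc q * (1 + min (K + 1 : ℝ≥0) (a * ρ)) ≤ q * (1 + (k + 2)) := by gcongr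
      _ ≤ 4 * r := by
        rw [← NNReal.coe_le_coe]
        push_cast
        linarith
  · calc q * (1 + min (K + 1 : ℝ≥0) (a * ρ)) ≤ 1 * (1 + 1) := by
          gcongr
          exact (min_le_right _ _).trans (not_lt.1 h1)
      _ ≤ 4 * r := by
        rw [← NNReal.coe_le_coe]
        push_cast
        linarith

end LowerBound

section Order

variable {M : Type} [Nonempty M] {n : ℕ}

/-- The state of `U` that comes first in the order `e`; arbitrary if `U` is empty. -/
noncomputable def firstIn (e : M ≃ Fin n) (U : Finset M) : M :=
  Classical.epsilon fun x => x ∈ U ∧ ∀ y ∈ U, e x ≤ e y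

variable {e : M ≃ Fin n} {U U' : Finset M} {x : M}

theorem firstIn_spec (e : M ≃ Fin n) (hU : U.Nonempty) :
    firstIn e U ∈ U ∧ ∀ y ∈ U, e (firstIn e U) ≤ e y :=
  Classical.epsilon_spec (U.exists_min_image e hU)

theorem firstIn_mem (e : M ≃ Fin n) (hU : U.Nonempty) : firstIn e U ∈ U :=
  (firstIn_spec e hU).1

theorem firstIn_eq_iff (hx : x ∈ U) : firstIn e U = x ↔ ∀ y ∈ U, e x ≤ e y := by
  obtain ⟨hmem, hle⟩ := firstIn_spec e ⟨x, hx⟩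
  exact ⟨fun h => h ▸ hle, fun h => e.injective ((hle x hx).antisymm (h _ hmem))⟩

theorem firstIn_of_subset (hU : U' ⊆ U) (h : firstIn e U ∈ U') : firstIn e U' = firstIn e U :=
  (firstIn_eq_iff h).2 fun _ hy => (firstIn_spec e ⟨_, hU h⟩).2 _ (hU hy)

theorem firstIn_trans_eq_iff {σ : M ≃ M} (hσ : ∀ z, z ∈ U ↔ σ z ∈ U) (hx : x ∈ U) :
    firstIn (σ.trans e) U = x ↔ firstIn e U = σ x := by
  rw [firstIn_eq_iff hx, firstIn_eq_iff ((hσ x).1 hx),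
    ← σ.forall_congr_right (q := fun y => y ∈ U → e (σ x) ≤ e y)]
  simp only [Equiv.trans_apply, ← hσ]

theorem card_mul_card_firstIn [Fintype M] [DecidableEq M] (hx : x ∈ U) :
    U.card * (Finset.univ.filter fun e : M ≃ Fin n => firstIn e U = x).card =
      Fintype.card (M ≃ Fin n) := by
  have hswap : ∀ y ∈ U, (Finset.univ.filter fun e : M ≃ Fin n => firstIn e U = y).card =
      (Finset.univ.filter fun e : M ≃ Fin n => firstIn e U = x).card := fun y hy => by
    have hσ : ∀ z, z ∈ U ↔ Equiv.swap x y z ∈ U := fun z => by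
      rw [Equiv.swap_apply_def]
      split_ifs <;> simp_all
    refine Finset.card_equiv ((Equiv.swap x y).equivCongr (Equiv.refl _)) fun e => ?_
    have h := firstIn_trans_eq_iff (e := e) hσ hx
    rw [Equiv.swap_apply_left] at h
    simpa [Equiv.equivCongr] using h.symm
  rw [← smul_eq_mul, ← Finset.sum_const, ← Finset.sum_congr rfl hswap, ← Finset.card_univ]
  exact (Finset.card_eq_sum_card_fiberwise fun e _ => firstIn_mem e ⟨x, hx⟩).symm

/-- The random order `e` is spread with profile `β`: a given state of `U` comes first in `U` with
probability at most `β |U|`. -/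
def IsSpread {Ω : Type} [MeasurableSpace Ω] (μ : Measure Ω) (e : Ω → M ≃ Fin n)
    (β : ℕ → ℝ≥0) : Prop :=
  ∀ U : Finset M, ∀ x ∈ U, μ {ω | firstIn (e ω) U = x} ≤ β U.card

theorem isSpread_one {Ω : Type} [MeasurableSpace Ω] (μ : Measure Ω) [IsProbabilityMeasure μ]
    (e : Ω → M ≃ Fin n) : IsSpread μ e 1 := fun _ _ _ => by
  simpa using prob_le_one

theorem isSpread_uniformOn_univ [Finite M] [MeasurableSpace (M ≃ Fin n)]
    [DiscreteMeasurableSpace (M ≃ Fin n)] :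
    IsSpread (ProbabilityTheory.uniformOn (.univ : Set (M ≃ Fin n))) id fun u => (u : ℝ≥0)⁻¹ := by
  classical
  have := Fintype.ofFinite M
  intro U x hx
  have hset : {e : M ≃ Fin n | firstIn (id e) U = x} =
      (Finset.univ.filter fun e : M ≃ Fin n => firstIn e U = x : Finset (M ≃ Fin n)) := by
    simp
  have hU : (U.card : ℝ≥0∞) ≠ 0 := Nat.cast_ne_zero.2 (Finset.card_ne_zero_of_mem hx)
  rw [ProbabilityTheory.uniformOn_univ, hset, Measure.count_apply_finset,
    ← card_mul_card_firstIn hx, ENNReal.coe_inv (mod_cast hU), Nat.cast_mul]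
  refine ENNReal.div_le_of_le_mul ?_
  rw [ENNReal.coe_natCast, ← mul_assoc,
    ENNReal.inv_mul_cancel hU (ENNReal.natCast_ne_top _), one_mul]

section Lintegral

variable {Ω : Type} [MeasurableSpace Ω] [DiscreteMeasurableSpace Ω] {μ : Measure Ω}
  {e : Ω → M ≃ Fin n} {β : ℕ → ℝ≥0}

theorem IsSpread.lintegral_firstIn_le (hμ : IsSpread μ e β) (hU : U.Nonempty) (g : M → ℝ≥0∞) :
    ∫⁻ ω, g (firstIn (e ω) U) ∂μ ≤ β U.card * ∑ x ∈ U, g x := by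
  classical
  have hsum : ∀ ω, g (firstIn (e ω) U) =
      ∑ x ∈ U, {ω | firstIn (e ω) U = x}.indicator (fun _ => g x) ω := fun ω => by
    simp only [Set.indicator, Set.mem_ofPred_eq]
    rw [Finset.sum_ite_eq, if_pos (firstIn_mem (e ω) hU)]
  simp only [hsum]
  rw [lintegral_finsetSum _ fun x _ => .of_discrete, Finset.mul_sum]
  refine Finset.sum_le_sum fun x hx => ?_
  rw [lintegral_indicator_const .of_discrete, mul_comm]
  exact mul_le_mul' (hμ U x hx) le_rfl

theorem IsSpread.lintegral_edist_firstIn_le [MetricSpace M] [DecidableEq M]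
    (hM : ∀ x y : M, edist x y ≤ 1) (hμ : IsSpread μ e β) (hU : U.Nonempty) (hU' : U' ⊆ U) :
    ∫⁻ ω, edist (firstIn (e ω) U) (firstIn (e ω) U') ∂μ ≤ β U.card * (U \ U').card := by
  calc _ ≤ ∫⁻ ω, ((U' : Set M)ᶜ.indicator 1) (firstIn (e ω) U) ∂μ := by
        refine lintegral_mono fun ω => ?_
        by_cases h : firstIn (e ω) U ∈ U'
        · simp [firstIn_of_subset hU' h]
        · simpa [h] using hM _ _
    _ ≤ β U.card * ∑ x ∈ U, (U' : Set M)ᶜ.indicator 1 x := hμ.lintegral_firstIn_le hU _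
    _ = β U.card * (U \ U').card := by
        simp [Set.indicator_apply, Finset.sum_ite, Finset.sdiff_eq_filter]

end Lintegral

end Order

section Phase

variable {M : Type} [Fintype M]

/-- The states on which less than cost `1` has accumulated. -/
noncomputable def unsaturated (W : CostFn M) : Finset M :=
  open Classical in Finset.univ.filter fun x => W x < 1

theorem mem_unsaturated {W : CostFn M} {x : M} : x ∈ unsaturated W ↔ W x < 1 := by
  simp [unsaturated]

theorem unsaturated_zero : unsaturated (0 : CostFn M) = Finset.univ := by
  ext x
  simp [mem_unsaturated]

theorem unsaturated_add_subset (W c : CostFn M) : unsaturated (W + c) ⊆ unsaturated W :=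
  fun _ hx => mem_unsaturated.2 (le_self_add.trans_lt ((mem_unsaturated (W := W + c)).1 hx))

/-- The update of the accumulated costs `W` when the task `c` arrives: a new phase begins once every
state is saturated. -/
noncomputable def phaseStep (W c : CostFn M) : CostFn M :=
  open Classical in if (unsaturated (W + c)).Nonempty then W + c else 0

/-- The costs accumulated after `t` steps in the current phase. -/
noncomputable def phaseCost (ℓ : ℕ → CostFn M) : ℕ → CostFn M
  | 0 => 0
  | t + 1 => phaseStep (phaseCost ℓ t) (ℓ (t + 1))

/-- The number of phases completed after `t` steps. -/
noncomputable def phaseCount (ℓ : ℕ → CostFn M) : ℕ → ℕ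
  | 0 => 0
  | t + 1 => open Classical in
    if (unsaturated (phaseCost ℓ t + ℓ (t + 1))).Nonempty then phaseCount ℓ t
    else phaseCount ℓ t + 1

theorem UniformMetric.min_one_add_le {n : ℕ} (W c : CostFn (UniformMetric n))
    (x y : UniformMetric n) : min 1 (W y + c y) ≤ min 1 (W x) + (edist x y + c y) := by
  by_cases h : x = y
  · rw [h, edist_self, zero_add, ← min_add_add_right]
    exact min_le_min le_self_add le_rfl
  · rw [edist_of_ne h]
    exact (min_le_left _ _).trans (le_self_add.trans le_add_self)

theorem phaseCount_add_min_le_cost {n : ℕ} (ℓ : ℕ → CostFn (UniformMetric n))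
    (y : ℕ → UniformMetric n) (t : ℕ) :
    phaseCount ℓ t + min 1 (phaseCost ℓ t (y t)) ≤ cost ℓ t y := by
  induction t with
  | zero => simp [phaseCount, phaseCost]
  | succ t ih =>
    have hstep : phaseCount ℓ t + min 1 (phaseCost ℓ t (y (t + 1)) + ℓ (t + 1) (y (t + 1))) ≤
        cost ℓ (t + 1) y := by
      rw [cost_succ]
      refine (add_le_add le_rfl (UniformMetric.min_one_add_le _ _ (y t) _)).trans ?_
      rw [← add_assoc]
      exact add_le_add ih le_rfl
    by_cases hne : (unsaturated (phaseCost ℓ t + ℓ (t + 1))).Nonempty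
    · simpa only [phaseCount, phaseCost, phaseStep, if_pos hne, Pi.add_apply] using hstep
    · have hsat : 1 ≤ phaseCost ℓ t (y (t + 1)) + ℓ (t + 1) (y (t + 1)) :=
        not_lt.1 fun h => hne ⟨y (t + 1), mem_unsaturated.2 h⟩
      simpa [phaseCount, phaseCost, phaseStep, if_neg hne, min_eq_left hsat] using hstep

end Phase

section Potential

variable {M : Type} {β : ℕ → ℝ≥0}

/-- The sum `β 1 + ⋯ + β u`. -/
noncomputable def partialSum (β : ℕ → ℝ≥0) (u : ℕ) : ℝ≥0 := ∑ i ∈ Finset.range u, β (i + 1)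

theorem mul_add_partialSum_le (hβ : AntitoneOn β (Set.Ici 1)) (u d : ℕ) :
    β (u + d) * d + partialSum β u ≤ partialSum β (u + d) := by
  rw [partialSum, partialSum, Finset.sum_range_add, add_comm]
  gcongr
  have hsum : (Finset.range d).card • β (u + d) ≤ ∑ i ∈ Finset.range d, β (u + i + 1) := by
    refine Finset.card_nsmul_le_sum _ _ _ fun i hi => ?_
    have hi := Finset.mem_range.1 hi
    exact hβ (Set.mem_Ici.2 (by omega)) (Set.mem_Ici.2 (by omega)) (by omega)
  rwa [Finset.card_range, nsmul_eq_mul, mul_comm] at hsum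

theorem mul_card_sdiff_add_partialSum_le [DecidableEq M] (hβ : AntitoneOn β (Set.Ici 1))
    {U U' : Finset M} (hU' : U' ⊆ U) :
    (β U.card * (U \ U').card + partialSum β U'.card : ℝ≥0∞) ≤ partialSum β U.card := by
  have h := mul_add_partialSum_le hβ U'.card (U \ U').card
  rw [add_comm U'.card, Finset.card_sdiff_add_card_eq_card hU'] at h
  exact_mod_cast h

theorem sum_le_card {U : Finset M} {W : CostFn M} (hW : ∀ x ∈ U, W x ≤ 1) :
    ∑ x ∈ U, W x ≤ U.card :=
  (Finset.sum_le_card_nsmul _ _ 1 hW).trans_eq (by simp)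

theorem mul_sum_le_partialSum (hβ : AntitoneOn β (Set.Ici 1)) {U : Finset M} {W : CostFn M}
    (hW : ∀ x ∈ U, W x ≤ 1) : β U.card * ∑ x ∈ U, W x ≤ partialSum β U.card := by
  classical
  have h := mul_card_sdiff_add_partialSum_le hβ U.empty_subset
  rw [Finset.sdiff_empty] at h
  exact (mul_le_mul' le_rfl (sum_le_card hW)).trans (le_self_add.trans h)

theorem partialSum_add_mul_sum_le (hβ : AntitoneOn β (Set.Ici 1)) {U U' : Finset M}
    (hU' : U' ⊆ U) (hne : U'.Nonempty) {W : CostFn M} (hW : ∀ x ∈ U, W x ≤ 1) :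
    partialSum β U'.card + β U.card * ∑ x ∈ U, W x ≤
      partialSum β U.card + (β U'.card : ℝ≥0∞) * ∑ x ∈ U', W x := by
  classical
  have hcard := Finset.card_pos.2 hne
  have hanti : (β U.card : ℝ≥0∞) ≤ β U'.card := ENNReal.coe_le_coe.2 <|
    hβ hcard (hcard.trans_le (Finset.card_le_card hU')) (Finset.card_le_card hU')
  have hsdiff : ∑ x ∈ U \ U', W x ≤ (U \ U').card :=
    sum_le_card fun x hx => hW x (Finset.mem_sdiff.1 hx).1
  calc _ = partialSum β U'.card + (β U.card * ∑ x ∈ U \ U', W x + β U.card * ∑ x ∈ U', W x) := by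
        rw [← Finset.sum_sdiff hU', mul_add]
    _ ≤ partialSum β U'.card + (β U.card * (U \ U').card + β U'.card * ∑ x ∈ U', W x) := by gcongr
    _ = (β U.card * (U \ U').card + partialSum β U'.card) + β U'.card * ∑ x ∈ U', W x := by ring
    _ ≤ _ := by
        gcongr
        exact mul_card_sdiff_add_partialSum_le hβ hU'

variable [Fintype M]

/-- The potential of the marking algorithm. When the `u` unsaturated states shrink to `u'`, one
summand `partialSum β u` pays for moving out of the saturated states, while the other one pays for
the cost accumulated on these, which is no longer counted in the second term. -/
noncomputable def phasePotential (β : ℕ → ℝ≥0) (W : CostFn M) : ℝ≥0∞ :=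
  2 * partialSum β (unsaturated W).card -
    β (unsaturated W).card * ∑ x ∈ unsaturated W, W x

theorem phasePotential_zero :
    phasePotential β (0 : CostFn M) = 2 * partialSum β (Fintype.card M) := by
  simp [phasePotential, unsaturated_zero]

theorem mul_sum_unsaturated_le_partialSum (hβ : AntitoneOn β (Set.Ici 1)) (W : CostFn M) :
    β (unsaturated W).card * ∑ x ∈ unsaturated W, W x ≤ partialSum β (unsaturated W).card :=
  mul_sum_le_partialSum hβ fun _ hx => (mem_unsaturated.1 hx).le

theorem phasePotential_add_le [DecidableEq M] (hβ : AntitoneOn β (Set.Ici 1)) {W c : CostFn M}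
    (hne : (unsaturated (W + c)).Nonempty) :
    β (unsaturated W).card * (unsaturated W \ unsaturated (W + c)).card +
        β (unsaturated (W + c)).card * ∑ x ∈ unsaturated (W + c), c x +
      phasePotential β (W + c) ≤ phasePotential β W := by
  have hsub := unsaturated_add_subset W c
  have hmove := mul_card_sdiff_add_partialSum_le hβ hsub
  have hsat := partialSum_add_mul_sum_le hβ hsub hne fun x hx => (mem_unsaturated.1 hx).le
  have hW := mul_sum_unsaturated_le_partialSum hβ W
  have hWc := mul_sum_unsaturated_le_partialSum hβ (W + c)
  simp only [phasePotential, Pi.add_apply, Finset.sum_add_distrib, mul_add] at hWc ⊢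
  set U := unsaturated W
  set U' := unsaturated (W + c)
  set S := β U.card * ∑ x ∈ U, W x
  set S' := β U'.card * ∑ x ∈ U', W x
  set P := β U'.card * ∑ x ∈ U', c x
  have hS : S ≠ ⊤ := ne_top_of_le_ne_top ENNReal.coe_ne_top hW
  have hS' : S' ≠ ⊤ := ne_top_of_le_ne_top ENNReal.coe_ne_top (le_self_add.trans hWc)
  have hcancel : 2 * partialSum β U'.card - (S' + P) + (S' + P) = 2 * partialSum β U'.card :=
    tsub_add_cancel_of_le (hWc.trans (le_mul_of_one_le_left' one_le_two))
  refine ENNReal.le_sub_of_add_le_right hS ((ENNReal.add_le_add_iff_right hS').1 ?_)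
  calc _ = β U.card * (U \ U').card + (2 * partialSum β U'.card - (S' + P) + (S' + P)) + S := by
        ring
    _ = (β U.card * (U \ U').card + partialSum β U'.card) + (partialSum β U'.card + S) := by
        rw [hcancel]
        ring
    _ ≤ partialSum β U.card + (partialSum β U.card + S') := add_le_add hmove hsat
    _ = _ := by ring

end Potential

section Marking

variable {M : Type} {n : ℕ}

/-- A state on which the task `c` is cheapest. -/
noncomputable def cheapest [Nonempty M] (c : CostFn M) : M :=
  Classical.epsilon fun x => ∀ y, c x ≤ c y

theorem cheapest_le [Finite M] [Nonempty M] (c : CostFn M) (y : M) : c (cheapest c) ≤ c y :=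
  Classical.epsilon_spec (Finite.exists_min c) y

variable [Fintype M]

theorem foldl_phaseStep_hist (A : DetAlg M) (ℓ : ℕ → CostFn M) (p : ℕ → M) (t : ℕ) :
    ((A.hist ℓ p t).map Prod.fst).foldl phaseStep 0 = phaseCost ℓ t := by
  induction t with
  | zero => rfl
  | succ t ih => simp [DetAlg.hist, ih, phaseCost]

variable [Nonempty M]

/-- The state chosen by the marking algorithm when the task `c` arrives in a phase in which the
costs `W` have accumulated: the first unsaturated state in the order `e`, and a cheapest state if
the phase ends. -/
noncomputable def markingMove (e : M ≃ Fin n) (W c : CostFn M) : M :=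
  open Classical in
  if (unsaturated (W + c)).Nonempty then firstIn e (unsaturated (W + c)) else cheapest c

/-- The marking algorithm of Borodin, Linial and Saks for the order `e` of the states. Its move on
the empty history, which never occurs, is arbitrary. -/
noncomputable def markingAlg (e : M ≃ Fin n) : DetAlg M where
  query _ _ := false
  move h := h.getLast?.elim (Classical.arbitrary M) fun s =>
    markingMove e ((h.dropLast.map Prod.fst).foldl phaseStep 0) s.1

theorem markingAlg_state_succ (e : M ≃ Fin n) (x₀ : M) (ℓ : ℕ → CostFn M) (p : ℕ → M) (t : ℕ) :
    (markingAlg e).state x₀ ℓ p (t + 1) = markingMove e (phaseCost ℓ t) (ℓ (t + 1)) := by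
  rw [← foldl_phaseStep_hist (markingAlg e) ℓ p t]
  simp [DetAlg.state, DetAlg.hist, markingAlg]

variable [MetricSpace M]

/-- The cost of the marking algorithm up to time `t`, plus the cost of then moving to the first
unsaturated state; the algorithm is elsewhere only at the beginning of a phase. -/
noncomputable def markingCost (e : M ≃ Fin n) (x₀ : M) (ℓ : ℕ → CostFn M) (p : ℕ → M) (t : ℕ) :
    ℝ≥0∞ :=
  cost ℓ t ((markingAlg e).state x₀ ℓ p) +
    edist ((markingAlg e).state x₀ ℓ p t) (firstIn e (unsaturated (phaseCost ℓ t)))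

theorem markingCost_succ_le (e : M ≃ Fin n) (x₀ : M) {ℓ : ℕ → CostFn M} (p : ℕ → M) {t : ℕ}
    (hne : (unsaturated (phaseCost ℓ t + ℓ (t + 1))).Nonempty) :
    markingCost e x₀ ℓ p (t + 1) ≤ markingCost e x₀ ℓ p t +
      (edist (firstIn e (unsaturated (phaseCost ℓ t)))
          (firstIn e (unsaturated (phaseCost ℓ t + ℓ (t + 1)))) +
        ℓ (t + 1) (firstIn e (unsaturated (phaseCost ℓ t + ℓ (t + 1))))) := by
  simp only [markingCost, cost_succ, markingAlg_state_succ, phaseCost, phaseStep, markingMove,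
    if_pos hne, edist_self, add_zero]
  rw [add_assoc, ← add_assoc (edist _ _)]
  gcongr
  exact edist_triangle _ _ _

theorem markingCost_succ_le_add_two (hM : ∀ x y : M, edist x y ≤ 1) (e : M ≃ Fin n) (x₀ : M)
    {ℓ : ℕ → CostFn M} (p : ℕ → M) {t : ℕ}
    (hne : ¬(unsaturated (phaseCost ℓ t + ℓ (t + 1))).Nonempty) (y : M) :
    markingCost e x₀ ℓ p (t + 1) ≤ markingCost e x₀ ℓ p t + (2 + ℓ (t + 1) y) := by
  have hcheap := cheapest_le (ℓ (t + 1)) y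
  have hstate : (markingAlg e).state x₀ ℓ p (t + 1) = cheapest (ℓ (t + 1)) := by
    rw [markingAlg_state_succ, markingMove, if_neg hne]
  rw [markingCost, markingCost, cost_succ, hstate]
  calc _ ≤ cost ℓ t ((markingAlg e).state x₀ ℓ p) + (1 + ℓ (t + 1) y) + 1 := by
        gcongr <;> exact hM _ _
    _ = cost ℓ t ((markingAlg e).state x₀ ℓ p) + (2 + ℓ (t + 1) y) := by ring
    _ ≤ _ := by
        gcongr
        exact le_self_add

variable {Ω : Type} [MeasurableSpace Ω] [DiscreteMeasurableSpace Ω] {μ : Measure Ω}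
  {e : Ω → M ≃ Fin n} {β : ℕ → ℝ≥0}

theorem lintegral_markingCost_succ_add_le (hM : ∀ x y : M, edist x y ≤ 1) (hμ : IsSpread μ e β)
    (hβ : AntitoneOn β (Set.Ici 1)) (x₀ : M) {ℓ : ℕ → CostFn M} (p : ℕ → M) {t : ℕ}
    (hne : (unsaturated (phaseCost ℓ t + ℓ (t + 1))).Nonempty) :
    ∫⁻ ω, markingCost (e ω) x₀ ℓ p (t + 1) ∂μ + phasePotential β (phaseCost ℓ (t + 1)) ≤
      ∫⁻ ω, markingCost (e ω) x₀ ℓ p t ∂μ + phasePotential β (phaseCost ℓ t) := by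
  classical
  set W := phaseCost ℓ t
  set c := ℓ (t + 1)
  have hstep : phaseCost ℓ (t + 1) = W + c := if_pos hne
  have hsub := unsaturated_add_subset W c
  have hcost : ∫⁻ ω, markingCost (e ω) x₀ ℓ p (t + 1) ∂μ ≤ ∫⁻ ω, markingCost (e ω) x₀ ℓ p t ∂μ +
      (β (unsaturated W).card * (unsaturated W \ unsaturated (W + c)).card +
        β (unsaturated (W + c)).card * ∑ x ∈ unsaturated (W + c), c x) := by
    refine (lintegral_mono fun ω => markingCost_succ_le (e ω) x₀ p hne).trans ?_
    rw [lintegral_add_left .of_discrete, lintegral_add_left .of_discrete]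
    gcongr
    · exact hμ.lintegral_edist_firstIn_le hM (hne.mono hsub) hsub
    · exact hμ.lintegral_firstIn_le hne c
  rw [hstep]
  refine (add_le_add hcost le_rfl).trans ?_
  rw [add_assoc]
  exact add_le_add le_rfl (phasePotential_add_le hβ hne)

theorem lintegral_markingCost_add_phasePotential_le [IsProbabilityMeasure μ]
    (hM : ∀ x y : M, edist x y ≤ 1) (hμ : IsSpread μ e β) (hβ : AntitoneOn β (Set.Ici 1))
    (x₀ : M) (ℓ : ℕ → CostFn M) (p y : ℕ → M) (t : ℕ) :
    ∫⁻ ω, markingCost (e ω) x₀ ℓ p t ∂μ + phasePotential β (phaseCost ℓ t) ≤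
      phaseCount ℓ t * (2 * partialSum β (Fintype.card M) + 2) + cost ℓ t y +
        (2 * partialSum β (Fintype.card M) + 1) := by
  induction t with
  | zero =>
    have hzero : ∀ ω, markingCost (e ω) x₀ ℓ p 0 ≤ 1 := fun ω => by
      simpa [markingCost, cost] using hM _ _
    rw [phaseCost, phasePotential_zero, add_comm]
    refine (add_le_add le_rfl ((lintegral_mono hzero).trans_eq ?_)).trans le_add_self
    simp
  | succ t ih =>
    rw [cost_succ]
    by_cases hne : (unsaturated (phaseCost ℓ t + ℓ (t + 1))).Nonempty
    · rw [phaseCount, if_pos hne]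
      refine (lintegral_markingCost_succ_add_le hM hμ hβ x₀ p hne).trans (ih.trans ?_)
      gcongr
      exact le_self_add
    · have hcost : ∫⁻ ω, markingCost (e ω) x₀ ℓ p (t + 1) ∂μ ≤
          ∫⁻ ω, markingCost (e ω) x₀ ℓ p t ∂μ + (2 + ℓ (t + 1) (y (t + 1))) := by
        refine (lintegral_mono fun ω =>
          markingCost_succ_le_add_two hM (e ω) x₀ p hne (y (t + 1))).trans ?_
        rw [lintegral_add_right _ measurable_const, lintegral_const, measure_univ, mul_one]
      rw [phaseCount, if_neg hne, phaseCost, phaseStep, if_neg hne, phasePotential_zero]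
      push_cast
      calc _ ≤ (∫⁻ ω, markingCost (e ω) x₀ ℓ p t ∂μ + (2 + ℓ (t + 1) (y (t + 1)))) +
            2 * partialSum β (Fintype.card M) := by gcongr
        _ ≤ (phaseCount ℓ t * (2 * partialSum β (Fintype.card M) + 2) + cost ℓ t y +
              (2 * partialSum β (Fintype.card M) + 1) +
              (2 + (edist (y t) (y (t + 1)) + ℓ (t + 1) (y (t + 1))))) +
            2 * partialSum β (Fintype.card M) := by
          gcongr
          · exact le_self_add.trans ih
          · exact le_add_self
        _ = _ := by ring

end Marking

section UpperBound

variable {n : ℕ}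

theorem RandAlg.isCompetitive_of_marking [Nonempty (UniformMetric n)]
    {R : RandAlg (UniformMetric n)} [DiscreteMeasurableSpace R.Ω] {β : ℕ → ℝ≥0}
    {e : R.Ω → UniformMetric n ≃ Fin n} (hR : ∀ ω, R.alg ω = markingAlg (e ω))
    (hμ : IsSpread R.μ e β) (hβ : AntitoneOn β (Set.Ici 1)) (x₀ : UniformMetric n) :
    R.IsCompetitive x₀ (2 * partialSum β n + 3) := by
  refine .of_forall_cost (κ := 2 * partialSum β n + 1) fun ℓ p T y _ => ?_
  have hmarking := lintegral_markingCost_add_phasePotential_le UniformMetric.edist_le_one hμ hβ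
    x₀ ℓ p y T
  rw [UniformMetric.card_eq] at hmarking
  have hphases : (phaseCount ℓ T : ℝ≥0∞) ≤ cost ℓ T y :=
    le_self_add.trans (phaseCount_add_min_le_cost ℓ y T)
  push_cast
  calc R.expectedCost x₀ ℓ p T ≤ ∫⁻ ω, markingCost (e ω) x₀ ℓ p T ∂(R.μ) :=
        lintegral_mono fun ω => by
          rw [hR ω]
          exact le_self_add
    _ ≤ _ := le_self_add.trans hmarking
    _ ≤ cost ℓ T y * (2 * partialSum β n + 2) + cost ℓ T y + (2 * partialSum β n + 1) := by gcongr
    _ = _ := by ring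

theorem detRatio_le (x₀ : UniformMetric n) : detRatio x₀ ≤ 2 * n + 3 := by
  have : Nonempty (UniformMetric n) := ⟨x₀⟩
  let e : UniformMetric n ≃ Fin n := Fintype.equivFinOfCardEq UniformMetric.card_eq
  have : DiscreteMeasurableSpace (markingAlg e).toRand.Ω :=
    ⟨fun _ => MeasurableSpace.measurableSet_top⟩
  have hcomp := RandAlg.isCompetitive_of_marking (R := (markingAlg e).toRand) (e := fun _ => e)
    (fun _ => rfl) (isSpread_one _ _) antitoneOn_const x₀
  refine (iInf₂_le _ ⟨markingAlg e, fun _ _ => rfl, hcomp⟩).trans_eq ?_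
  simp [partialSum]

instance : MeasurableSpace (UniformMetric n ≃ Fin n) := ⊤

instance : DiscreteMeasurableSpace (UniformMetric n ≃ Fin n) :=
  ⟨fun _ => MeasurableSpace.measurableSet_top⟩

/-- The marking algorithm with a uniformly random order of the states. -/
noncomputable def randMarkingAlg (n : ℕ) [Nonempty (UniformMetric n)] :
    RandAlg (UniformMetric n) :=
  haveI : Nonempty (UniformMetric n ≃ Fin n) :=
    ⟨Fintype.equivFinOfCardEq UniformMetric.card_eq⟩
  { Ω := UniformMetric n ≃ Fin n
    μ := ProbabilityTheory.uniformOn .univ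
    alg := markingAlg
    measurable_state := fun _ _ _ _ _ => .of_discrete
    measurable_queried := fun _ _ _ => .of_discrete }

theorem randRatio_le (x₀ : UniformMetric n) :
    randRatio x₀ ≤ ENNReal.ofReal (2 * Real.log n + 5) := by
  have : Nonempty (UniformMetric n) := ⟨x₀⟩
  have : DiscreteMeasurableSpace (randMarkingAlg n).Ω :=
    inferInstanceAs (DiscreteMeasurableSpace (UniformMetric n ≃ Fin n))
  have hanti : AntitoneOn (fun u : ℕ => (u : ℝ≥0)⁻¹) (Set.Ici 1) := fun i hi j _ hij => by
    have hi : (0 : ℝ≥0) < i := Nat.cast_pos.2 hi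
    dsimp only
    gcongr
  have hspread := isSpread_uniformOn_univ (M := UniformMetric n) (n := n)
  have hcomp := RandAlg.isCompetitive_of_marking (R := randMarkingAlg n) (fun _ => rfl)
    hspread hanti x₀
  have hharmonic := harmonic_le_one_add_log n
  have hsum : ((harmonic n : ℚ) : ℝ) = partialSum (fun u => (u : ℝ≥0)⁻¹) n := by
    simp [harmonic, partialSum]
  refine (iInf₂_le _ ⟨randMarkingAlg n, fun _ _ _ => rfl, hcomp⟩).trans ?_
  rw [← ENNReal.ofReal_coe_nnreal]
  refine ENNReal.ofReal_le_ofReal ?_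
  push_cast
  linarith

end UpperBound

theorem min_one_add_mul_le {α : ℝ≥0∞} {C K : ℝ≥0} (hC : 1 ≤ C) (hα : α ≤ (C * (1 + K) : ℝ≥0))
    (a : ℕ) (ρ : ℝ≥0) : min α (1 + a * ρ) ≤ (C * (1 + min K (a * ρ)) : ℝ≥0) := by
  rw [← min_add_add_left, mul_min, ENNReal.coe_min]
  exact min_le_min hα (mod_cast le_mul_of_one_le_left' hC)

section Ratio

variable {n : ℕ} {x₀ : UniformMetric n}

theorem log_le_natLog_add_one (n : ℕ) : Real.log n ≤ Nat.log 2 n + 1 := by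
  rcases n.eq_zero_or_pos with rfl | hn
  · simp
  calc Real.log n ≤ Real.log (2 ^ (Nat.log 2 n + 1)) :=
        Real.log_le_log (Nat.cast_pos.2 hn) <|
          mod_cast (Nat.lt_pow_succ_log_self one_lt_two n).le
    _ = (Nat.log 2 n + 1) * Real.log 2 := by
        rw [Real.log_pow]
        push_cast
        rfl
    _ ≤ Nat.log 2 n + 1 := mul_le_of_le_one_right (by positivity) <|
        Real.log_two_lt_d9.le.trans (by norm_num)

theorem le_two_mul_detRatio (x₀ : UniformMetric n) : (n : ℝ≥0∞) ≤ 2 * detRatio x₀ := by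
  rw [← ENNReal.inv_mul_le_iff two_ne_zero ENNReal.ofNat_ne_top]
  refine le_iInf₂ fun r ⟨A, _, hA⟩ => ?_
  rw [ENNReal.inv_mul_le_iff two_ne_zero ENNReal.ofNat_ne_top]
  have hn : n - 1 + 1 = n := Nat.sub_add_cancel (UniformMetric.pos x₀)
  have h := hA.le_two_mul (A.isEvadable x₀) (k := n - 1) hn.le
  rw [mul_one] at h
  rw [← hn]
  exact_mod_cast h

theorem log_le_four_mul_randRatio (x₀ : UniformMetric n) :
    ENNReal.ofReal (Real.log n) ≤ 4 * randRatio x₀ := by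
  rw [← ENNReal.inv_mul_le_iff four_ne_zero ENNReal.ofNat_ne_top]
  refine le_iInf₂ fun r ⟨R, _, hR⟩ => ?_
  rw [ENNReal.inv_mul_le_iff four_ne_zero ENNReal.ofNat_ne_top]
  have h : (Nat.log 2 n * 2⁻¹ + 1 : ℝ) ≤ 2 * r :=
    hR.le_two_mul (R.isEvadable x₀) (Nat.pow_log_le_self 2 (UniformMetric.pos x₀).ne')
  have hlog : Real.log n ≤ (4 * r : ℝ≥0) := by
    push_cast
    linarith [log_le_natLog_add_one n]
  exact (ENNReal.ofReal_le_ofReal hlog).trans_eq (by simp)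

theorem min_detRatio_le {A : DetAlg (UniformMetric n)} {off : OptimalOffline x₀} {a : ℕ}
    (hsep : A.WellSeparated a) {ρ r : ℝ≥0} (hA : A.toRand.IsCompetitiveWithError x₀ off ρ r) :
    min (detRatio x₀) (1 + a * ρ) ≤ 12 * r := by
  have hn : n - 1 + 1 = n := Nat.sub_add_cancel (UniformMetric.pos x₀)
  have h := hA.mul_one_add_min_le (fun _ => hsep) (A.isEvadable x₀) le_rfl (K := n - 1)
    fun k hk => by omega
  rw [one_mul, ← Nat.cast_add_one, hn] at h
  have hratio : detRatio x₀ ≤ (3 * (1 + n) : ℝ≥0) := by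
    refine (detRatio_le x₀).trans ?_
    exact_mod_cast (show 2 * n + 3 ≤ 3 * (1 + n) by omega)
  refine (min_one_add_mul_le (by norm_num) hratio a ρ).trans ?_
  calc ((3 * (1 + min (n : ℝ≥0) (a * ρ)) : ℝ≥0) : ℝ≥0∞) ≤ (3 * (4 * r) : ℝ≥0) := by gcongr
    _ = 12 * r := by
        push_cast
        ring

theorem min_randRatio_le {R : RandAlg (UniformMetric n)} {off : OptimalOffline x₀} {a : ℕ}
    (hsep : R.WellSeparated a) {ρ r : ℝ≥0} (hR : R.IsCompetitiveWithError x₀ off ρ r) :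
    min (randRatio x₀) (1 + a * ρ) ≤ 32 * r := by
  have h := hR.mul_one_add_min_le hsep (R.isEvadable x₀) (by norm_num) (K := Nat.log 2 n)
    fun k hk => Nat.pow_le_of_le_log (UniformMetric.pos x₀).ne' hk
  have hratio : randRatio x₀ ≤ (4 * (1 + (Nat.log 2 n + 1)) : ℝ≥0) := by
    refine (randRatio_le x₀).trans ?_
    rw [← ENNReal.ofReal_coe_nnreal]
    refine ENNReal.ofReal_le_ofReal ?_
    push_cast
    linarith [log_le_natLog_add_one n]
  refine (min_one_add_mul_le (by norm_num) hratio a ρ).trans ?_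
  rw [inv_mul_le_iff₀ two_pos] at h
  calc ((4 * (1 + min (Nat.log 2 n + 1 : ℝ≥0) (a * ρ)) : ℝ≥0) : ℝ≥0∞) ≤
        (4 * (2 * (4 * r)) : ℝ≥0) := by gcongr
    _ = 32 * r := by
        push_cast
        ring

theorem detRatio_le_ten_mul (x₀ : UniformMetric n) : detRatio x₀ ≤ 10 * n := by
  have hn := UniformMetric.pos x₀
  exact (detRatio_le x₀).trans (mod_cast show 2 * n + 3 ≤ 10 * n by omega)

theorem randRatio_le_ten_mul_log (hn : 2 ≤ n) (x₀ : UniformMetric n) :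
    randRatio x₀ ≤ 10 * ENNReal.ofReal (Real.log n) := by
  have hlog : Real.log 2 ≤ Real.log n := Real.log_le_log two_pos (mod_cast hn)
  rw [← ENNReal.ofReal_ofNat 10, ← ENNReal.ofReal_mul (by norm_num)]
  exact (randRatio_le x₀).trans
    (ENNReal.ofReal_le_ofReal (by linarith [Real.log_two_gt_d9]))

end Ratio

theorem exists_le_randRatio (x : ℝ≥0) :
    ∃ (n : ℕ) (x₀ : UniformMetric n), (x : ℝ≥0∞) ≤ randRatio x₀ := by
  obtain ⟨n, hn⟩ := exists_nat_ge (Real.exp (4 * x))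
  have hpos : 0 < n := Nat.cast_pos.1 ((Real.exp_pos _).trans_le hn)
  refine ⟨n, (⟨0, hpos⟩ : Fin n), ?_⟩
  have hlog : 4 * (x : ℝ) ≤ Real.log n := (Real.le_log_iff_exp_le (Nat.cast_pos.2 hpos)).2 hn
  have h := (ENNReal.ofReal_le_ofReal hlog).trans
    (log_le_four_mul_randRatio (n := n) (⟨0, hpos⟩ : Fin n))
  rwa [ENNReal.ofReal_mul (by norm_num), ENNReal.ofReal_ofNat, ENNReal.ofReal_coe_nnreal,
    ENNReal.mul_le_mul_iff_right four_ne_zero ENNReal.ofNat_ne_top] at h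

theorem one_add_le_of_forall_isCompetitiveWithError
    {off : (n : ℕ) → (x₀ : UniformMetric n) → OptimalOffline x₀}
    {R : (n : ℕ) → UniformMetric n → RandAlg (UniformMetric n)} {a : ℕ} {ρ r : ℝ≥0}
    (hsep : ∀ n x₀, (R n x₀).WellSeparated a)
    (hR : ∀ n x₀, (R n x₀).IsCompetitiveWithError x₀ (off n x₀) ρ r) : 1 + a * ρ ≤ 32 * r := by
  obtain ⟨n, x₀, hn⟩ := exists_le_randRatio (1 + a * ρ)
  have h := min_randRatio_le (hsep n x₀) (hR n x₀)
  rw [min_eq_right (mod_cast hn)] at h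
  exact_mod_cast h

theorem eventually_not_isSmooth (off : (n : ℕ) → (x₀ : UniformMetric n) → OptimalOffline x₀)
    {ι : Type*} {l : Filter ι} {f : ℕ → ℝ≥0 → ℝ≥0} {a : ι → ℕ} {ρ : ι → ℝ≥0}
    (hf : (fun k => (f (a k) (ρ k) : ℝ)) =o[l] (fun k => (a k : ℝ) * (ρ k : ℝ))) :
    ∀ᶠ k in l, ¬ ∃ R : (n : ℕ) → UniformMetric n → RandAlg (UniformMetric n),
      ∀ (n : ℕ) (x₀ : UniformMetric n), (R n x₀).WellSeparated (a k) ∧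
        (R n x₀).IsSmooth x₀ (off n x₀) (f (a k)) := by
  filter_upwards [hf.def (show (0 : ℝ) < 32⁻¹ by norm_num)] with k hk
  rintro ⟨R, hR⟩
  have hlow : (1 + a k * ρ k : ℝ) ≤ 32 * f (a k) (ρ k) :=
    one_add_le_of_forall_isCompetitiveWithError (fun n x₀ => (hR n x₀).1) fun n x₀ =>
      (hR n x₀).2 (ρ k)
  rw [Real.norm_of_nonneg (by positivity), Real.norm_of_nonneg (by positivity)] at hk
  linarith

theorem coe_inv_mul_le_of_le_mul {b x y : ℝ≥0∞} {C : ℝ≥0} (hC : C ≠ 0) (hb : b ≤ C)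
    (h : x ≤ b * y) : ((C⁻¹ : ℝ≥0) : ℝ≥0∞) * x ≤ y := by
  rw [ENNReal.coe_inv hC, ENNReal.inv_mul_le_iff (mod_cast hC) ENNReal.coe_ne_top]
  exact h.trans (mul_le_mul' hb le_rfl)

end MTS

theorem mainTheorem5 :
    ∃ c C : ℝ≥0, 0 < c ∧
      -- `α_n = Θ(n)` for deterministic and `α_n = Θ(log n)` for randomized algorithms
      (∀ (n : ℕ) (x₀ : MTS.UniformMetric n),
        (c : ℝ≥0∞) * n ≤ MTS.detRatio x₀ ∧ MTS.detRatio x₀ ≤ C * n) ∧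
      (∀ n : ℕ, 2 ≤ n → ∀ x₀ : MTS.UniformMetric n,
        (c : ℝ≥0∞) * ENNReal.ofReal (Real.log n) ≤ MTS.randRatio x₀ ∧
          MTS.randRatio x₀ ≤ C * ENNReal.ofReal (Real.log n)) ∧
      -- the lower bound for deterministic algorithms
      (∀ (n : ℕ) (x₀ : MTS.UniformMetric n) (off : MTS.OptimalOffline x₀) (a : ℕ), 1 ≤ a →
        ∀ A : MTS.DetAlg (MTS.UniformMetric n), A.WellSeparated a →
        ∀ ρ r : ℝ≥0, A.toRand.IsCompetitiveWithError x₀ off ρ r →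
          (c : ℝ≥0∞) * min (MTS.detRatio x₀) (1 + a * ρ) ≤ r) ∧
      -- the lower bound for randomized algorithms
      (∀ (n : ℕ) (x₀ : MTS.UniformMetric n) (off : MTS.OptimalOffline x₀) (a : ℕ), 1 ≤ a →
        ∀ R : MTS.RandAlg (MTS.UniformMetric n), R.WellSeparated a →
        ∀ ρ r : ℝ≥0, R.IsCompetitiveWithError x₀ off ρ r →
          (c : ℝ≥0∞) * min (MTS.randRatio x₀) (1 + a * ρ) ≤ r) ∧
      -- no `o(a η / OPT)`-smooth algorithm, in any regime in which `a η / OPT` tends to infinity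
      (∀ off : (n : ℕ) → (x₀ : MTS.UniformMetric n) → MTS.OptimalOffline x₀,
        ∀ (f : ℕ → ℝ≥0 → ℝ≥0) (a : ℕ → ℕ) (ρ : ℕ → ℝ≥0),
          Tendsto (fun k => (a k : ℝ) * (ρ k : ℝ)) atTop atTop →
          (fun k => (f (a k) (ρ k) : ℝ)) =o[atTop] (fun k => (a k : ℝ) * (ρ k : ℝ)) →
          ∀ᶠ k in atTop,
            ¬ ∃ R : (n : ℕ) → MTS.UniformMetric n → MTS.RandAlg (MTS.UniformMetric n),
              ∀ (n : ℕ) (x₀ : MTS.UniformMetric n), (R n x₀).WellSeparated (a k) ∧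
                (R n x₀).IsSmooth x₀ (off n x₀) (f (a k))) := by
  have h32 : (32 : ℝ≥0) ≠ 0 := by norm_num
  refine ⟨32⁻¹, 10, by norm_num, fun n x₀ => ⟨?_, MTS.detRatio_le_ten_mul x₀⟩,
    fun n hn x₀ => ⟨?_, MTS.randRatio_le_ten_mul_log hn x₀⟩,
    fun n x₀ off a _ A hsep ρ r hA => ?_, fun n x₀ off a _ R hsep ρ r hR => ?_,
    fun off f a ρ _ hf => MTS.eventually_not_isSmooth off hf⟩
  · exact MTS.coe_inv_mul_le_of_le_mul h32 (by norm_num) (MTS.le_two_mul_detRatio x₀)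
  · exact MTS.coe_inv_mul_le_of_le_mul h32 (by norm_num) (MTS.log_le_four_mul_randRatio x₀)
  · exact MTS.coe_inv_mul_le_of_le_mul h32 (by norm_num) (MTS.min_detRatio_le hsep hA)
  · exact MTS.coe_inv_mul_le_of_le_mul h32 le_rfl (MTS.min_randRatio_le hsep hR)
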